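/- Let $(\mathcal{E},\langle\cdot,\cdot\rangle)$ be a finite-dimensional real inner product space equipped with a Euclidean Jordan algebra structure, i.e. a bilinear product $\circ$ with a unit $e$ such that $y\circ z=z\circ y$, $y\circ(y^2\circ z)=y^2\circ(y\circ z)$ (where $y^2=y\circ y$) and $\langle y\circ z,w\rangle=\langle y,z\circ w\rangle$ for all $y,z,w\in\mathcal{E}$. Let $\mathcal{K}=\{y\circ y : y\in\mathcal{E}\}$ be its cone of squares. A Jordan frame is a family $c_1,\dots,c_r$ of primitive idempotents with $c_i\circ c_j=0$ for $i\ne j$ and $c_1+\dots+c_r=e$ (an idempotent is primitive if it is nonzero and is not the sum of two nonzero idempotents $a,b$ with $a\circ b=0$); its length $r$ depends only on $\mathcal{E}$ and is called the rank of $\mathcal{E}$. Every $y\in\mathcal{E}$ can be written $y=\sum_{i=1}^r\sigma_i c_i$ with a Jordan frame $c_1,\dots,c_r$ and real numbers $\sigma_i$ (the eigenvalues of $y$); $\operatorname{rank} y$ is the number of nonzero $\sigma_i$, and for $y\in\mathcal{K}$ one sets $\sqrt{y}=\sum_{i=1}^r\sqrt{\sigma_i}\,c_i$. Let $f:\mathbb{R}^n\to\mathbb{R}$,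 $h:\mathbb{R}^n\to\mathbb{R}^m$ and $g:\mathbb{R}^n\to\mathcal{E}$ be twice continuously differentiable, and consider the nonlinear symmetric cone problem $$\text{minimize } f(x)\quad\text{subject to } h(x)=0,\ g(x)\in\mathcal{K},\ x\in\mathbb{R}^n,$$ with Lagrangian $L(x,\mu,\lambda)=f(x)-\langle h(x),\mu\rangle-\langle g(x),\lambda\rangle$. Let $(x,\mu,\lambda)\in\mathbb{R}^n\times\mathbb{R}^m\times\mathcal{E}$ be a KKT triple, that is, $$\nabla f(x)-Jh(x)^*\mu-Jg(x)^*\lambda=0,\quad \lambda\in\mathcal{K},\quad g(x)\in\mathcal{K},\quad \lambda\circ g(x)=0,\quad h(x)=0,$$ where $Jg,Jh$ are the Jacobians and $^*$ denotes the adjoint. Suppose that $$\langle\nabla_x^2L(x,\mu,\lambda)v,v\rangle+2\langle w\circ w,\lambda\rangle>0$$ for every nonzero $(v,w)\in\mathbb{R}^n\times\mathcal{E}$ such that $Jg(x)v-2\sqrt{g(x)}\circ w=0$ and $Jh(x)v=0$. Then $x$ is a strict local minimum of the problem (for some neighbourhood $U$ of $x$, every feasible $z\in U$ with $z\neq x$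 satisfies $f(z)>f(x)$), $\lambda\in\mathcal{K}$, and strict complementarity holds: $\operatorname{rank} g(x)+\operatorname{rank}\lambda=r$, where $r$ is the rank of $\mathcal{E}$. -/

import Mathlib

open Topology Filter

/-- A (unital) Euclidean Jordan algebra structure on a real inner product space `E`: a bilinear
product that is commutative, satisfies the Jordan identity, and is associative with respect to the
inner product of `E`. -/
structure EuclideanJordanAlgebra (E : Type*) [NormedAddCommGroup E] [InnerProductSpace ℝ E] where
  /-- The Jordan product `y ∘ z`. -/
  prod : E →ₗ[ℝ] E →ₗ[ℝ] E
  /-- The unit element `e`. -/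
  one : E
  prod_comm : ∀ y z, prod y z = prod z y
  jordan : ∀ y z, prod y (prod (prod y y) z) = prod (prod y y) (prod y z)
  inner_prod : ∀ y z w, inner ℝ (prod y z) w = inner ℝ y (prod z w)
  prod_one : ∀ y, prod y one = y

namespace EuclideanJordanAlgebra

variable {E : Type*} [NormedAddCommGroup E] [InnerProductSpace ℝ E]

/-- The cone of squares `{y ∘ y | y ∈ E}`. -/
def cone (J : EuclideanJordanAlgebra E) : Set E := {z | ∃ y, J.prod y y = z}

/-- `c` is idempotent: `c ∘ c = c`. -/
def IsIdempotent (J : EuclideanJordanAlgebra E) (c : E) : Prop := J.prod c c = c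

/-- A primitive idempotent: a nonzero idempotent that is not the sum of two nonzero idempotents
`a`, `b` with `a ∘ b = 0`. -/
def IsPrimitive (J : EuclideanJordanAlgebra E) (c : E) : Prop :=
  J.IsIdempotent c ∧ c ≠ 0 ∧
    ¬ ∃ a b, J.IsIdempotent a ∧ J.IsIdempotent b ∧ a ≠ 0 ∧ b ≠ 0 ∧ J.prod a b = 0 ∧ c = a + b

/-- A Jordan frame: primitive idempotents, pairwise orthogonal for the Jordan product, with sum
the unit element. -/
def IsJordanFrame (J : EuclideanJordanAlgebra E) {r : ℕ} (c : Fin r → E) : Prop :=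
  (∀ i, J.IsPrimitive (c i)) ∧ (∀ i j, i ≠ j → J.prod (c i) (c j) = 0) ∧ ∑ i, c i = J.one

/-- A spectral decomposition `y = σ₁ c₁ + ⋯ + σᵣ cᵣ` of `y` along a Jordan frame `c₁, …, cᵣ`; the
numbers `σᵢ` are the eigenvalues of `y`. -/
structure SpectralDecomposition (J : EuclideanJordanAlgebra E) (y : E) where
  /-- The number of elements of the frame. -/
  size : ℕ
  /-- The Jordan frame. -/
  frame : Fin size → E
  /-- The eigenvalues, with multiplicity. -/
  eig : Fin size → ℝ
  isJordanFrame : J.IsJordanFrame frame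
  eq_sum : y = ∑ i, eig i • frame i

open Classical in
/-- The rank of `y`: the number of nonzero eigenvalues in a spectral decomposition of `y`. By the
spectral theorem, in finite dimension a decomposition exists and the number does not depend on
the one that is chosen. -/
noncomputable def rank (J : EuclideanJordanAlgebra E) (y : E) : ℕ :=
  if h : Nonempty (J.SpectralDecomposition y) then
    (Finset.univ.filter fun i => (Classical.choice h).eig i ≠ 0).card
  else 0

open Classical in
/-- The square root of `y` (meant for `y` in the cone of squares, where the eigenvalues are
nonnegative): `√σ₁ c₁ + ⋯ + √σᵣ cᵣ` for a spectral decomposition `y = σ₁ c₁ + ⋯ + σᵣ cᵣ`. By the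
spectral theorem, in finite dimension a decomposition exists and the sum does not depend on the
one that is chosen. -/
noncomputable def sqrt (J : EuclideanJordanAlgebra E) (y : E) : E :=
  if h : Nonempty (J.SpectralDecomposition y) then
    ∑ i, Real.sqrt ((Classical.choice h).eig i) • (Classical.choice h).frame i
  else 0

/-- The rank `r` of the algebra: the number of elements of a Jordan frame (in finite dimension,
Jordan frames exist and all have the same number of elements). -/
noncomputable def algRank (J : EuclideanJordanAlgebra E) : ℕ :=
  sInf {r | ∃ c : Fin r → E, J.IsJordanFrame c}

end EuclideanJordanAlgebra

namespace SymmetricConeProblem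

variable {n m : ℕ} {E : Type*} [NormedAddCommGroup E] [InnerProductSpace ℝ E]

/-- The feasible set of the nonlinear symmetric cone problem
`minimize f(x) subject to h(x) = 0, g(x) ∈ K`, with `K` the cone of squares of `J`. -/
def feasibleSet (J : EuclideanJordanAlgebra E)
    (h : EuclideanSpace ℝ (Fin n) → EuclideanSpace ℝ (Fin m))
    (g : EuclideanSpace ℝ (Fin n) → E) : Set (EuclideanSpace ℝ (Fin n)) :=
  {x | h x = 0 ∧ g x ∈ J.cone}

/-- The Lagrangian `L(x, μ, λ) = f(x) - ⟨h(x), μ⟩ - ⟨g(x), λ⟩`. -/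
noncomputable def lagrangian (f : EuclideanSpace ℝ (Fin n) → ℝ)
    (h : EuclideanSpace ℝ (Fin n) → EuclideanSpace ℝ (Fin m))
    (g : EuclideanSpace ℝ (Fin n) → E)
    (x : EuclideanSpace ℝ (Fin n)) (μ : EuclideanSpace ℝ (Fin m)) (lam : E) : ℝ :=
  f x - inner ℝ (h x) μ - inner ℝ (g x) lam

/-- The Hessian `∇²F(x)` as a linear operator: the derivative of the gradient. -/
noncomputable def hessian (F : EuclideanSpace ℝ (Fin n) → ℝ) (x : EuclideanSpace ℝ (Fin n)) :
    EuclideanSpace ℝ (Fin n) →L[ℝ] EuclideanSpace ℝ (Fin n) :=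
  fderiv ℝ (gradient F) x

/-- `(x, μ, λ)` is a Karush-Kuhn-Tucker triple. -/
structure IsKKT [FiniteDimensional ℝ E] (J : EuclideanJordanAlgebra E)
    (f : EuclideanSpace ℝ (Fin n) → ℝ)
    (h : EuclideanSpace ℝ (Fin n) → EuclideanSpace ℝ (Fin m))
    (g : EuclideanSpace ℝ (Fin n) → E)
    (x : EuclideanSpace ℝ (Fin n)) (μ : EuclideanSpace ℝ (Fin m)) (lam : E) : Prop where
  stationary : gradient f x - LinearMap.adjoint (fderiv ℝ h x).toLinearMap μ
    - LinearMap.adjoint (fderiv ℝ g x).toLinearMap lam = 0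
  multiplier_mem : lam ∈ J.cone
  constraint_mem : g x ∈ J.cone
  complementary : J.prod lam (g x) = 0
  eq_constraint : h x = 0

/-- Strict complementarity: `rank g(x) + rank λ = r`. -/
def StrictComplementarity (J : EuclideanJordanAlgebra E) (g : EuclideanSpace ℝ (Fin n) → E)
    (x : EuclideanSpace ℝ (Fin n)) (lam : E) : Prop :=
  J.rank (g x) + J.rank lam = J.algRank

/-- `x` is a strict local minimum of `f` over the set `S`. -/
def IsStrictLocalMinOn (f : EuclideanSpace ℝ (Fin n) → ℝ) (S : Set (EuclideanSpace ℝ (Fin n)))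
    (x : EuclideanSpace ℝ (Fin n)) : Prop :=
  x ∈ S ∧ ∀ᶠ z in 𝓝 x, z ∈ S → z ≠ x → f x < f z

end SymmetricConeProblem

namespace EuclideanJordanAlgebra

variable {E : Type*} [NormedAddCommGroup E] [InnerProductSpace ℝ E] (J : EuclideanJordanAlgebra E)

/-! A slack variable y turns g(x) ∈ K into the equality g(x) = y∘y, and the hypothesis is the second
order sufficient condition of the new problem at (x, √g(x)). If x is not a strict local minimum,
feasible points z ≠ x with f(z) ≤ f(x) accumulate at x. Their roots y_z in the cone tend to √g(x),
by uniqueness of square roots in K, and the normalized increments (z − x, y_z − √g(x)) accumulate at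
some (v, w) ≠ 0 that satisfies the linearized constraints. Since √g(x)∘λ = 0, the cross term of
y_z∘y_z drops out and L(z) − L(x) ≤ −⟨(y_z − √g(x))², λ⟩. Dividing by the squared norm of the
increment gives ⟨∇²L v, v⟩ + 2⟨w∘w, λ⟩ ≤ 0, a contradiction (`IsKKT.isStrictLocalMinOn`).

For strict complementarity put v = 0: then ⟨w∘w, λ⟩ > 0 for every w ≠ 0 with √g(x)∘w = 0. The
idempotents carrying g(x) are orthogonal to those carrying λ, and e minus their sum is such a w but
is annihilated by λ. So it is 0, and the two families together form a Jordan frame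
(`rank_add_rank_eq_algRank`).

The Jordan algebra behind this is power associativity (`prod_eval_eval`), positivity of
multiplication by an idempotent (`IsIdempotent.inner_prod_self`), the spectral theorem
(`exists_primitive_system`), and the invariance of the length of Jordan frames (`IsSystem.card_eq`).
Below, L(y) denotes the operator `J.prod y`. -/

theorem one_prod (y : E) : J.prod J.one y = y := by rw [J.prod_comm, J.prod_one]

/-- Polarization: the part odd in w of the Jordan identity at y + w, minus its cubic part, which is
the identity at w. -/
theorem jordan_linearized (y w z : E) :
    J.prod w (J.prod (J.prod y y) z) + (2 : ℝ) • J.prod y (J.prod (J.prod y w) z)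
      = J.prod (J.prod y y) (J.prod w z) + (2 : ℝ) • J.prod (J.prod y w) (J.prod y z) := by
  have h1 := J.jordan (y + w) z
  have h2 := J.jordan (y - w) z
  have h3 := J.jordan w z
  simp only [map_add, map_sub, LinearMap.add_apply, LinearMap.sub_apply, J.prod_comm w y]
    at h1 h2
  linear_combination (norm := module) (1 / 2 : ℝ) • h1 - (1 / 2 : ℝ) • h2 - h3

theorem isSymmetric_prod (y : E) : (J.prod y).IsSymmetric := fun a b => by
  rw [J.prod_comm y a, J.inner_prod]

/-! ### Powers -/

/-- The value `p(y)` of a polynomial at an element of the algebra. -/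
noncomputable def eval (y : E) (p : Polynomial ℝ) : E :=
  Polynomial.aeval (R := ℝ) (A := Module.End ℝ E) (J.prod y) p J.one

@[simp] theorem eval_one (y : E) : J.eval y 1 = J.one := by simp [eval]

@[simp] theorem eval_X (y : E) : J.eval y Polynomial.X = y := by simp [eval, J.prod_one]

theorem eval_add (y : E) (p q : Polynomial ℝ) : J.eval y (p + q) = J.eval y p + J.eval y q := by
  simp [eval]

theorem eval_mul (y : E) (p q : Polynomial ℝ) :
    J.eval y (p * q) = Polynomial.aeval (R := ℝ) (A := Module.End ℝ E) (J.prod y) p (J.eval y q) := by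
  simp [eval]

theorem eval_monomial (y : E) (k : ℕ) (a : ℝ) :
    J.eval y (Polynomial.monomial k a) = a • J.eval y (Polynomial.X ^ k) := by
  simp [eval, ← Polynomial.C_mul_X_pow_eq_monomial, Algebra.algebraMap_eq_smul_one]

theorem eval_X_mul (y : E) (q : Polynomial ℝ) :
    J.eval y (Polynomial.X * q) = J.prod y (J.eval y q) := by
  simp [eval_mul]

theorem commute_prod_sq (y : E) :
    Commute (J.prod y : Module.End ℝ E) (J.prod (J.prod y y)) :=
  LinearMap.ext fun z => J.jordan y z

theorem eval_X_pow_add_two (y : E) (k : ℕ) :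
    J.eval y (Polynomial.X ^ (k + 2)) = J.prod (J.prod y y) (J.eval y (Polynomial.X ^ k)) := by
  have h := ((J.commute_prod_sq y).pow_left k)
  have h2 := LinearMap.congr_fun h J.one
  simp only [Module.End.mul_apply, J.prod_one] at h2
  simp only [eval, map_pow, Polynomial.aeval_X]
  rw [← h2, pow_add]
  simp [pow_two, J.prod_one]

/-- The linearized identity read as an equality of operators acting on w. With z = y^k it is a
two-step recursion for L(y^(k+2)). -/
theorem prod_sq_prod (y z : E) :
    (J.prod (J.prod (J.prod y y) z) : Module.End ℝ E)
      = (J.prod (J.prod y y) : Module.End ℝ E) * J.prod z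
        + (2 : ℝ) • ((J.prod (J.prod y z) : Module.End ℝ E) * J.prod y)
        - (2 : ℝ) • ((J.prod y : Module.End ℝ E) * J.prod z * J.prod y) := by
  ext w
  have h := J.jordan_linearized y w z
  simp only [LinearMap.sub_apply, LinearMap.add_apply, LinearMap.smul_apply,
    Module.End.mul_apply]
  rw [J.prod_comm w (J.prod _ z), J.prod_comm (J.prod y w) z, J.prod_comm w z,
    J.prod_comm (J.prod y w)] at h
  linear_combination (norm := module) h

/-- By the recursion, L(y^k) is built from the commuting operators L(y) and L(y²). -/
theorem commute_prod_eval_X_pow (y : E) (k : ℕ) :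
    Commute (J.prod (J.eval y (Polynomial.X ^ k)) : Module.End ℝ E) (J.prod y) ∧
      Commute (J.prod (J.eval y (Polynomial.X ^ k)) : Module.End ℝ E) (J.prod (J.prod y y)) := by
  induction k using Nat.twoStepInduction with
  | zero =>
    have h : (J.prod J.one : Module.End ℝ E) = 1 := LinearMap.ext fun z => J.one_prod z
    rw [pow_zero, eval_one, h]
    exact ⟨.one_left _, .one_left _⟩
  | one =>
    rw [pow_one, eval_X]
    exact ⟨.refl _, J.commute_prod_sq y⟩
  | more k h0 h1 =>
    have h : J.prod y (J.eval y (Polynomial.X ^ k)) = J.eval y (Polynomial.X ^ (k + 1)) := by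
      rw [pow_succ', eval_X_mul]
    rw [eval_X_pow_add_two, prod_sq_prod, h]
    have hc := J.commute_prod_sq y
    exact ⟨((hc.symm.mul_left h0.1).add_left ((h1.1.mul_left (.refl _)).smul_left _)).sub_left
        ((((Commute.refl _).mul_left h0.1).mul_left (.refl _)).smul_left _),
      (((Commute.refl _).mul_left h0.2).add_left ((h1.2.mul_left hc).smul_left _)).sub_left
        (((hc.mul_left h0.2).mul_left hc).smul_left _)⟩

/-- Power associativity: L(y^k) commutes with q(L(y)), so y^k ∘ q(y) = L(y^k) q(L(y)) e = q(L(y))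
y^k. -/
theorem prod_eval_eval (y : E) (p q : Polynomial ℝ) :
    J.prod (J.eval y p) (J.eval y q) = J.eval y (p * q) := by
  induction p using Polynomial.induction_on' with
  | add p₁ p₂ h₁ h₂ => simp only [add_mul, eval_add, map_add, LinearMap.add_apply, h₁, h₂]
  | monomial k a =>
    have h2 : J.eval y (Polynomial.monomial k a * q) = a • J.eval y (q * Polynomial.X ^ k) := by
      simp [eval, ← Polynomial.C_mul_X_pow_eq_monomial, Algebra.algebraMap_eq_smul_one, mul_assoc]
      rw [← Module.End.mul_apply, ← Module.End.mul_apply]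
      congr 2
      simpa using ((Polynomial.commute_X_pow q k).map
        (Polynomial.aeval (J.prod y : Module.End ℝ E))).eq
    have hc : Commute (J.prod (J.eval y (Polynomial.X ^ k)) : Module.End ℝ E)
        (Polynomial.aeval (J.prod y : Module.End ℝ E) q) :=
      Polynomial.induction_on' (motive := fun q => Commute _ (Polynomial.aeval (J.prod y : Module.End ℝ E) q)) q
        (fun p q hp hq => by rw [map_add]; exact hp.add_right hq)
        (fun n a => by
          rw [Polynomial.aeval_monomial]
          exact (Algebra.commute_algebraMap_right a _).mul_right ((J.commute_prod_eval_X_pow y k).1.pow_right n))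
    have h3 := LinearMap.congr_fun hc J.one
    simp only [Module.End.mul_apply, J.prod_one] at h3
    rw [eval_monomial, h2, eval_mul, map_smul, LinearMap.smul_apply, ← h3]
    rfl

/-! ### Idempotents -/

/-- The linearized identity at y = z = c. It says 2L³ − 3L² + L = 0 for L = L(c), so the eigenvalues
of L(c) lie in {0, 1/2, 1}. -/
theorem IsIdempotent.peirce {c : E} (hc : J.IsIdempotent c) (w : E) :
    J.prod c w + (2 : ℝ) • J.prod c (J.prod c (J.prod c w))
      = (3 : ℝ) • J.prod c (J.prod c w) := by
  have h := J.jordan_linearized c w c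
  have hc : J.prod c c = c := hc
  rw [hc, hc, J.prod_comm w c, J.prod_comm (J.prod c w) c] at h
  linear_combination (norm := module) h

/-- On the Peirce eigenvalues t = 0, 1/2, 1 one has t = t² + 4(t − t²)². This sum of squares shows
that L(c) is positive semidefinite and that its form vanishes at w only if c∘w = 0. -/
theorem IsIdempotent.inner_prod_self {c : E} (hc : J.IsIdempotent c) (w : E) :
    inner ℝ w (J.prod c w)
      = ‖J.prod c w‖ ^ 2 + 4 * ‖J.prod c w - J.prod c (J.prod c w)‖ ^ 2 := by
  have hs := J.isSymmetric_prod c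
  have h1 := hc.peirce J w
  have h2 := congrArg (J.prod c) h1
  simp only [map_add, map_smul] at h2
  have e1 := congrArg (inner ℝ w) h1
  have e2 := congrArg (inner ℝ w) h2
  simp only [inner_add_right, inner_smul_right] at e1 e2
  have a1 : inner ℝ (J.prod c w) (J.prod c w) = inner ℝ w (J.prod c (J.prod c w)) := hs _ _
  have a2 : inner ℝ (J.prod c w) (J.prod c (J.prod c w))
    = inner ℝ w (J.prod c (J.prod c (J.prod c w))) := hs _ _
  have a3 : inner ℝ (J.prod c (J.prod c w)) (J.prod c (J.prod c w))
    = inner ℝ w (J.prod c (J.prod c (J.prod c (J.prod c w)))) := by rw [hs, hs]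
  rw [norm_sub_sq_real, ← real_inner_self_eq_norm_sq, ← real_inner_self_eq_norm_sq, a1, a2, a3]
  linarith

theorem IsIdempotent.inner_prod_nonneg {c : E} (hc : J.IsIdempotent c) (w : E) :
    0 ≤ inner ℝ w (J.prod c w) := by
  rw [hc.inner_prod_self]; positivity

theorem IsIdempotent.inner_nonneg {c d : E} (hc : J.IsIdempotent c) (hd : J.IsIdempotent d) :
    0 ≤ inner ℝ c d := by
  have := hd.inner_prod_nonneg J c
  rwa [J.prod_comm, ← J.inner_prod, show J.prod c c = c from hc] at this

theorem IsIdempotent.prod_eq_zero {c d : E} (hc : J.IsIdempotent c) (hd : J.IsIdempotent d)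
    (h : inner ℝ c d = 0) : J.prod c d = 0 := by
  have h1 := hd.inner_prod_self J c
  rw [J.prod_comm d c, ← J.inner_prod, show J.prod c c = c from hc, h] at h1
  have : ‖J.prod c d‖ ^ 2 = 0 := by 
    have h2 := sq_nonneg (‖J.prod c d - J.prod d (J.prod c d)‖)
    have h3 := sq_nonneg (‖J.prod c d‖)
    linarith
  simpa using this

theorem inner_eq_zero_of_prod_eq_zero {c d : E} (h : J.prod c d = 0) : inner ℝ c d = 0 := by
  rw [← J.one_prod c, J.inner_prod, h, inner_zero_right]

/-- A summand of an idempotent `c`, in an orthogonal decomposition, is orthogonal to the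
idempotents orthogonal to `c`. -/
theorem IsIdempotent.prod_left_eq_zero {a b d : E} (ha : J.IsIdempotent a) (hb : J.IsIdempotent b)
    (hd : J.IsIdempotent d) (h : J.prod (a + b) d = 0) : J.prod a d = 0 := by
  apply ha.prod_eq_zero J hd
  have h1 := J.inner_eq_zero_of_prod_eq_zero h
  rw [inner_add_left] at h1
  linarith [ha.inner_nonneg J hd, hb.inner_nonneg J hd]

/-! ### Complete systems of idempotents and the spectral theorem -/

variable {J}

/-- A complete system of nonzero orthogonal idempotents. -/
structure IsSystem (s : Finset E) : Prop where
  idem : ∀ c ∈ s, J.IsIdempotent c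
  ne_zero : ∀ c ∈ s, c ≠ 0
  orth : ∀ c ∈ s, ∀ d ∈ s, c ≠ d → J.prod c d = 0
  sum_eq : ∑ c ∈ s, c = J.one

/-- `y` is a linear combination of the members of `s`. -/
def IsDiagonal (s : Finset E) (y : E) : Prop := ∃ σ : E → ℝ, y = ∑ c ∈ s, σ c • c

theorem IsSystem.prod_sum {s : Finset E} (hs : J.IsSystem s) (σ : E → ℝ) {c : E} (hc : c ∈ s) :
    J.prod (∑ d ∈ s, σ d • d) c = σ c • c := by
  rw [map_sum, LinearMap.sum_apply, Finset.sum_eq_single c]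
  · rw [map_smul, LinearMap.smul_apply, show J.prod c c = c from hs.idem c hc]
  · intro d hd hdc
    rw [map_smul, LinearMap.smul_apply, hs.orth d hd c hc hdc, smul_zero]
  · exact fun h => absurd hc h

/-- The unit is the sum of the members of s, and each of them is an eigenvector of L(y) for its
coefficient. -/
theorem IsSystem.eval_sum {s : Finset E} (hs : J.IsSystem s) (σ : E → ℝ) (p : Polynomial ℝ) :
    J.eval (∑ d ∈ s, σ d • d) p = ∑ d ∈ s, p.eval (σ d) • d := by
  rw [eval, ← hs.sum_eq, map_sum]
  refine Finset.sum_congr rfl fun c hc => ?_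
  exact Module.End.aeval_apply_of_hasEigenvector
    ⟨Module.End.mem_eigenspace_iff.2 (hs.prod_sum σ hc), hs.ne_zero c hc⟩

theorem IsSystem.sum_prod_sum {s : Finset E} (hs : J.IsSystem s) (σ τ : E → ℝ) :
    J.prod (∑ d ∈ s, σ d • d) (∑ d ∈ s, τ d • d) = ∑ d ∈ s, (σ d * τ d) • d := by
  rw [map_sum (J.prod _)]
  refine Finset.sum_congr rfl fun c hc => ?_
  rw [map_smul, hs.prod_sum σ hc, smul_smul, mul_comm]

theorem IsSystem.inner_sum {s : Finset E} (hs : J.IsSystem s) (σ : E → ℝ) {c : E} (hc : c ∈ s) :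
    inner ℝ (∑ d ∈ s, σ d • d) c = σ c * ‖c‖ ^ 2 := by
  rw [sum_inner, Finset.sum_eq_single c]
  · rw [inner_smul_left, real_inner_self_eq_norm_sq]; rfl
  · intro d hd hdc
    rw [inner_smul_left, J.inner_eq_zero_of_prod_eq_zero (hs.orth d hd c hc hdc), mul_zero]
  · exact fun h => absurd hc h

theorem IsSystem.linearIndependent {s : Finset E} (hs : J.IsSystem s) :
    LinearIndependent ℝ (fun c : s => (c : E)) :=
  linearIndependent_of_ne_zero_of_inner_eq_zero (fun c => hs.ne_zero c c.2)
    (fun c d h => J.inner_eq_zero_of_prod_eq_zero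
      (hs.orth c c.2 d d.2 fun e => h (Subtype.ext e)))

theorem IsSystem.card_le [FiniteDimensional ℝ E] {s : Finset E} (hs : J.IsSystem s) :
    s.card ≤ Module.finrank ℝ E := by
  simpa using hs.linearIndependent.fintype_card_le_finrank

theorem IsDiagonal.mem_span {s : Finset E} {y : E} (h : IsDiagonal s y) :
    y ∈ Submodule.span ℝ (s : Set E) := by
  obtain ⟨σ, rfl⟩ := h
  exact Submodule.sum_mem _ fun c hc => Submodule.smul_mem _ _ (Submodule.subset_span hc)

/-- A member of a system that is not primitive can be split. -/
theorem IsSystem.exists_refinement {s : Finset E} (hs : J.IsSystem s) {c : E} (hc : c ∈ s)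
    (hp : ¬ J.IsPrimitive c) :
    ∃ t : Finset E, J.IsSystem t ∧ t.card = s.card + 1 ∧ ∀ y, IsDiagonal s y → IsDiagonal t y := by
  classical
  obtain ⟨a, b, ha, hb, ha0, hb0, hab, rfl⟩ : ∃ a b, J.IsIdempotent a ∧ J.IsIdempotent b ∧
      a ≠ 0 ∧ b ≠ 0 ∧ J.prod a b = 0 ∧ c = a + b := by
    by_contra h
    exact hp ⟨hs.idem c hc, hs.ne_zero c hc, h⟩
  have key : ∀ d ∈ s.erase (a + b), J.prod a d = 0 ∧ J.prod b d = 0 := by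
    intro d hd
    have hds := Finset.mem_of_mem_erase hd
    have h := hs.orth _ hc d hds (Finset.ne_of_mem_erase hd).symm
    exact ⟨ha.prod_left_eq_zero J hb (hs.idem d hds) h,
      hb.prod_left_eq_zero J ha (hs.idem d hds) (by rwa [add_comm])⟩
  have haE : a ∉ s.erase (a + b) := fun h => ha0 (by rw [← show J.prod a a = a from ha, (key a h).1])
  have hbE : b ∉ s.erase (a + b) := fun h => hb0 (by rw [← show J.prod b b = b from hb, (key b h).2])
  have hne : a ≠ b := by
    rintro rfl
    exact ha0 (by rw [← show J.prod a a = a from ha, hab])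
  have haI : a ∉ insert b (s.erase (a + b)) := by simp [hne, haE]
  refine ⟨insert a (insert b (s.erase (a + b))), ⟨?_, ?_, ?_, ?_⟩, ?_, ?_⟩
  · simp only [Finset.mem_insert]
    rintro d (rfl | rfl | hd)
    exacts [ha, hb, hs.idem d (Finset.mem_of_mem_erase hd)]
  · simp only [Finset.mem_insert]
    rintro d (rfl | rfl | hd)
    exacts [ha0, hb0, hs.ne_zero d (Finset.mem_of_mem_erase hd)]
  · simp only [Finset.mem_insert]
    rintro d (rfl | rfl | hd) d' (rfl | rfl | hd') h
    · exact absurd rfl h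
    · exact hab
    · exact (key d' hd').1
    · rw [J.prod_comm]; exact hab
    · exact absurd rfl h
    · exact (key d' hd').2
    · rw [J.prod_comm]; exact (key d hd).1
    · rw [J.prod_comm]; exact (key d hd).2
    · exact hs.orth d (Finset.mem_of_mem_erase hd) d' (Finset.mem_of_mem_erase hd') h
  · rw [Finset.sum_insert haI, Finset.sum_insert hbE, ← add_assoc,
      Finset.add_sum_erase s (fun x => x) hc, hs.sum_eq]
  · rw [Finset.card_insert_of_notMem haI, Finset.card_insert_of_notMem hbE,
      Finset.card_erase_add_one hc]
  · rintro y ⟨σ, rfl⟩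
    refine ⟨fun d => if d = a ∨ d = b then σ (a + b) else σ d, ?_⟩
    rw [Finset.sum_insert haI, Finset.sum_insert hbE, ← Finset.add_sum_erase s _ hc, ← add_assoc]
    simp only [true_or, or_true, if_true, smul_add]
    congr 1
    refine Finset.sum_congr rfl fun d hd => ?_
    rw [if_neg]
    rintro (rfl | rfl)
    exacts [haE hd, hbE hd]

/-- The spectral projections of `L(y)`, applied to the unit, diagonalize `y`. -/
theorem exists_system_isDiagonal [FiniteDimensional ℝ E] (J : EuclideanJordanAlgebra E) (y : E) :
    ∃ s, J.IsSystem s ∧ IsDiagonal s y := by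
  classical
  have hT := J.isSymmetric_prod y
  let b := hT.eigenvectorBasis rfl
  let S : Finset ℝ := Finset.univ.image (hT.eigenvalues rfl)
  -- A polynomial vanishing on the spectrum of L(y) kills an eigenbasis. Hence p(y) depends only on
  -- the values of p on S, and Lagrange polynomials give the idempotents.
  have hzero : ∀ p : Polynomial ℝ, (∀ x ∈ S, p.eval x = 0) → J.eval y p = 0 := by
    intro p hp
    suffices h : Polynomial.aeval (R := ℝ) (A := Module.End ℝ E) (J.prod y) p = 0 by
      rw [eval, h]; rfl
    refine b.toBasis.ext fun i => ?_
    have := Module.End.aeval_apply_of_hasEigenvector (R := ℝ) (p := p) (hT.hasEigenvector_eigenvectorBasis rfl i)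
    rw [OrthonormalBasis.coe_toBasis, this, LinearMap.zero_apply]
    have h0 := hp _ (Finset.mem_image_of_mem _ (Finset.mem_univ i))
    exact (congrArg (· • _) h0).trans (zero_smul _ _)
  have heq : ∀ p q : Polynomial ℝ, (∀ x ∈ S, p.eval x = q.eval x) → J.eval y p = J.eval y q := by
    intro p q h
    have := hzero (p - q) fun x hx => by rw [Polynomial.eval_sub, h x hx, sub_self]
    rw [eval, map_sub, LinearMap.sub_apply, sub_eq_zero] at this
    exact this
  let ℓ : ℝ → Polynomial ℝ := fun x => Lagrange.basis S id x
  have hℓ : ∀ x ∈ S, ∀ z ∈ S, (ℓ x).eval z = if x = z then 1 else 0 := by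
    intro x hx z hz
    split_ifs with h
    · subst h; exact Lagrange.eval_basis_self (Set.injOn_id _) hx
    · exact Lagrange.eval_basis_of_ne (v := id) h hz
  let e : ℝ → E := fun x => J.eval y (ℓ x)
  have horth : ∀ x ∈ S, ∀ z ∈ S, x ≠ z → J.prod (e x) (e z) = 0 := by
    intro x hx z hz hxz
    rw [prod_eval_eval]
    refine hzero _ fun t ht => ?_
    rw [Polynomial.eval_mul, hℓ x hx t ht, hℓ z hz t ht]
    split_ifs <;> simp_all
  have hidem : ∀ x ∈ S, J.prod (e x) (e x) = e x := by
    intro x hx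
    rw [prod_eval_eval]
    refine heq _ _ fun t ht => ?_
    rw [Polynomial.eval_mul, hℓ x hx t ht]
    split_ifs <;> simp
  have hsum : ∀ p : Polynomial ℝ, J.eval y p = ∑ x ∈ S, p.eval x • e x := by
    intro p
    have : J.eval y p = J.eval y (∑ x ∈ S, Polynomial.C (p.eval x) * ℓ x) := by
      refine heq _ _ fun t ht => ?_
      rw [Polynomial.eval_finsetSum, Finset.sum_eq_single t]
      · rw [Polynomial.eval_mul, hℓ t ht t ht]; simp
      · intro x hx hxt
        rw [Polynomial.eval_mul, hℓ x hx t ht, if_neg hxt, mul_zero]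
      · exact fun h => absurd ht h
    rw [this, eval, map_sum, LinearMap.sum_apply]
    refine Finset.sum_congr rfl fun x _ => ?_
    simp [e, eval, Algebra.algebraMap_eq_smul_one]
  -- The spectrum of L(y) may contain means of two eigenvalues of y that are not eigenvalues of y
  -- themselves; there e x = 0, and such terms are discarded.
  let S' := S.filter fun x => e x ≠ 0
  have hinj : Set.InjOn e S' := by
    intro x hx z hz hxz
    by_contra hne
    simp only [S', Finset.coe_filter, Set.mem_ofPred_eq] at hx hz
    apply hx.2
    rw [← hidem x hx.1]
    nth_rw 2 [hxz]
    exact horth x hx.1 z hz.1 hne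
  have hsum' : ∀ p : Polynomial ℝ, J.eval y p = ∑ x ∈ S', p.eval x • e x := by
    intro p
    rw [hsum, Finset.sum_filter_of_ne]
    intro x _ h h0
    exact h (by rw [h0, smul_zero])
  refine ⟨S'.image e, ⟨?_, ?_, ?_, ?_⟩, Function.invFunOn e S', ?_⟩
  · simp only [Finset.mem_image, S', Finset.mem_filter]
    rintro _ ⟨x, hx, rfl⟩
    exact hidem x hx.1
  · simp only [Finset.mem_image, S', Finset.mem_filter]
    rintro _ ⟨x, hx, rfl⟩
    exact hx.2
  · simp only [Finset.mem_image, S', Finset.mem_filter]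
    rintro _ ⟨x, hx, rfl⟩ _ ⟨z, hz, rfl⟩ h
    exact horth x hx.1 z hz.1 fun h' => h (by rw [h'])
  · rw [Finset.sum_image hinj, ← J.eval_one y, hsum']
    simp
  · rw [Finset.sum_image hinj]
    refine (J.eval_X y).symm.trans ((hsum' _).trans (Finset.sum_congr rfl fun x hx => ?_))
    rw [hinj.leftInvOn_invFunOn hx, Polynomial.eval_X]

/-- The spectral theorem. -/
theorem exists_primitive_system [FiniteDimensional ℝ E] (J : EuclideanJordanAlgebra E) (y : E) :
    ∃ s, J.IsSystem s ∧ (∀ c ∈ s, J.IsPrimitive c) ∧ IsDiagonal s y := by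
  classical
  let P : ℕ → Prop := fun k => ∃ s, J.IsSystem s ∧ IsDiagonal s y ∧ s.card = k
  have hP : ∀ k, P k → k ≤ Module.finrank ℝ E := by
    rintro _ ⟨s, hs, -, rfl⟩
    exact hs.card_le
  obtain ⟨s₀, hs₀, hy₀⟩ := J.exists_system_isDiagonal y
  -- Among the systems diagonalizing y take a largest one: splitting a non-primitive member would
  -- enlarge it.
  obtain ⟨s, hs, hy, hcard⟩ : P (Nat.findGreatest P (Module.finrank ℝ E)) :=
    Nat.findGreatest_spec (hP _ ⟨s₀, hs₀, hy₀, rfl⟩) ⟨s₀, hs₀, hy₀, rfl⟩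
  refine ⟨s, hs, fun c hc => ?_, hy⟩
  by_contra hp
  obtain ⟨t, ht, htc, hd⟩ := hs.exists_refinement hc hp
  have hPt : P t.card := ⟨t, ht, hd y hy, rfl⟩
  have := Nat.le_findGreatest (hP _ hPt) hPt
  omega

/-! ### Jordan frames and systems -/

theorem injective_of_orthogonal {ι : Type*} {c : ι → E} (h : ∀ i, J.IsIdempotent (c i))
    (h0 : ∀ i, c i ≠ 0) (ho : ∀ i j, i ≠ j → J.prod (c i) (c j) = 0) :
    Function.Injective c := by
  intro i j hij
  by_contra hne
  have := ho i j hne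
  rw [← hij, show J.prod (c i) (c i) = c i from h i] at this
  exact h0 i this

theorem isSystem_image [DecidableEq E] {ι : Type*} [Fintype ι] {c : ι → E}
    (h : ∀ i, J.IsIdempotent (c i)) (h0 : ∀ i, c i ≠ 0)
    (ho : ∀ i j, i ≠ j → J.prod (c i) (c j) = 0) (hsum : ∑ i, c i = J.one) :
    J.IsSystem (Finset.univ.image c) := by
  refine ⟨?_, ?_, ?_, ?_⟩
  · simp only [Finset.mem_image, Finset.mem_univ, true_and]
    rintro _ ⟨i, rfl⟩
    exact h i
  · simp only [Finset.mem_image, Finset.mem_univ, true_and]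
    rintro _ ⟨i, rfl⟩
    exact h0 i
  · simp only [Finset.mem_image, Finset.mem_univ, true_and]
    rintro _ ⟨i, rfl⟩ _ ⟨j, rfl⟩ h
    exact ho i j fun h' => h (by rw [h'])
  · rw [Finset.sum_image (injective_of_orthogonal h h0 ho).injOn, hsum]

theorem IsSystem.isJordanFrame {s : Finset E} (hs : J.IsSystem s)
    (hp : ∀ c ∈ s, J.IsPrimitive c) :
    J.IsJordanFrame (fun i => (s.equivFin.symm i : E)) := by
  refine ⟨fun i => hp _ (s.equivFin.symm i).2, fun i j h => ?_, ?_⟩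
  · exact hs.orth _ (s.equivFin.symm i).2 _ (s.equivFin.symm j).2 fun h' =>
      h (s.equivFin.symm.injective (Subtype.ext h'))
  · rw [Equiv.sum_comp s.equivFin.symm (fun c : s => (c : E)), Finset.sum_coe_sort s (fun c => c),
      hs.sum_eq]

theorem nonempty_spectralDecomposition [FiniteDimensional ℝ E] (J : EuclideanJordanAlgebra E)
    (y : E) : Nonempty (J.SpectralDecomposition y) := by
  obtain ⟨s, hs, hp, σ, hσ⟩ := J.exists_primitive_system y
  refine ⟨⟨s.card, _, fun i => σ (s.equivFin.symm i), hs.isJordanFrame hp, ?_⟩⟩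
  rw [Equiv.sum_comp s.equivFin.symm (fun c : s => σ c • (c : E)),
    Finset.sum_coe_sort s (fun c => σ c • c), hσ]

/-! ### Limits of systems and the length of Jordan frames -/

variable (J)

section Topology

variable [FiniteDimensional ℝ E]

theorem continuous_prod {X : Type*} [TopologicalSpace X] {a b : X → E} (ha : Continuous a)
    (hb : Continuous b) : Continuous fun x => J.prod (a x) (b x) :=
  (J.prod.toContinuousBilinearMap.continuous.comp ha).clm_apply hb

theorem analyticOnNhd_eval {a : ℝ → E} (ha : AnalyticOnNhd ℝ a Set.univ) (p : Polynomial ℝ) :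
    AnalyticOnNhd ℝ (fun t => J.eval (a t) p) Set.univ := by
  have hB : ∀ b : ℝ → E, AnalyticOnNhd ℝ b Set.univ →
      AnalyticOnNhd ℝ (fun t => J.prod (a t) (b t)) Set.univ := fun b hb t ht =>
    (J.prod.toContinuousBilinearMap.analyticAt_bilinear (a t, b t)).comp₂ (ha t ht) (hb t ht)
  induction p using Polynomial.induction_on' with
  | add p q hp hq =>
    simp only [eval_add]
    exact hp.add hq
  | monomial k c =>
    simp only [eval_monomial]
    refine AnalyticOnNhd.smul analyticOnNhd_const ?_
    induction k with
    | zero => simpa using analyticOnNhd_const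
    | succ k ih => simpa only [pow_succ', eval_X_mul] using hB _ ih

theorem exists_norm_prod_le : ∃ M : ℝ, ∀ a b, ‖J.prod a b‖ ≤ M * ‖a‖ * ‖b‖ :=
  ⟨_, J.prod.toContinuousBilinearMap.le_opNorm₂⟩

end Topology

variable {J}

theorem IsIdempotent.norm_le {c : E} (hc : J.IsIdempotent c) : ‖c‖ ≤ ‖J.one‖ := by
  have h : ‖c‖ ^ 2 = inner ℝ c J.one := by
    rw [← real_inner_self_eq_norm_sq]
    nth_rw 3 [← show J.prod c c = c from hc]
    rw [J.inner_prod, J.prod_one]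
  have h2 := real_inner_le_norm c J.one
  by_contra! hlt
  nlinarith [norm_nonneg J.one, norm_nonneg c]

theorem IsSystem.eq_zero_of_inner {s : Finset E} (hs : J.IsSystem s) {σ : E → ℝ} {c : E}
    (hc : c ∈ s) (h : inner ℝ (∑ d ∈ s, σ d • d) c = 0) : σ c = 0 := by
  rw [hs.inner_sum σ hc] at h
  exact (mul_eq_zero.1 h).resolve_right (pow_ne_zero _ (norm_ne_zero_iff.2 (hs.ne_zero c hc)))

/-- With distinct coefficients, every member of a system is a Lagrange polynomial in the resulting
combination. -/
theorem exists_injOn_real {α : Type*} (s : Finset α) : ∃ σ : α → ℝ, Set.InjOn σ s := by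
  classical
  refine ⟨fun c => if h : c ∈ s then ((s.equivFin ⟨c, h⟩ : ℕ) : ℝ) else 0, ?_⟩
  intro c hc d hd h
  have hc : c ∈ s := hc
  have hd : d ∈ s := hd
  simp only [hc, hd, dite_true, Nat.cast_inj] at h
  simpa using s.equivFin.injective (Fin.ext h)

/-- Elements diagonalized by systems of a fixed size form a closed set. -/
theorem isDiagonal_of_frequently [FiniteDimensional ℝ E] {N : ℕ} {z : ℝ → E} {z₀ : E}
    {l : Filter ℝ} (hz : Tendsto z l (𝓝 z₀))
    (h : ∃ᶠ t in l, ∃ s, J.IsSystem s ∧ s.card = N ∧ IsDiagonal s (z t)) :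
    ∃ s, J.IsSystem s ∧ s.card = N ∧ IsDiagonal s z₀ := by
  classical
  obtain ⟨M, hM⟩ := J.exists_norm_prod_le
  -- From ‖c‖ = ‖c∘c‖ ≤ M‖c‖². This closed condition replaces c ≠ 0, so no idempotent degenerates in
  -- the limit.
  have hM' : ∀ c, J.IsIdempotent c → c ≠ 0 → 1 ≤ M * ‖c‖ := by
    intro c hc h0
    have h1 := hM c c
    rw [show J.prod c c = c from hc] at h1
    have h2 : 0 < ‖c‖ := norm_pos_iff.2 h0
    by_contra! h3
    nlinarith
  -- Bounds the coefficients: |σ| ‖c‖ ≤ ‖z t‖ by Cauchy–Schwarz, and 1 ≤ |M| ‖c‖.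
  let R : ℝ := (‖z₀‖ + 1) * |M|
  let K : Set ((Fin N → ℝ) × (Fin N → E)) :=
    Metric.closedBall 0 R ×ˢ Metric.closedBall 0 ‖J.one‖ ∩
      {p | (∀ i, J.prod (p.2 i) (p.2 i) = p.2 i) ∧ (∀ i, 1 ≤ M * ‖p.2 i‖) ∧
        (∀ i j, i ≠ j → J.prod (p.2 i) (p.2 j) = 0) ∧ ∑ i, p.2 i = J.one}
  have hcont : ∀ i, Continuous fun p : (Fin N → ℝ) × (Fin N → E) => p.2 i := fun i => by fun_prop
  have hKc : IsCompact K := by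
    refine ((isCompact_closedBall _ _).prod (isCompact_closedBall _ _)).inter_right ?_
    refine IsClosed.and ?_ (IsClosed.and ?_ (IsClosed.and ?_ ?_))
    · rw [Set.ofPred_forall]
      exact isClosed_iInter fun i => isClosed_eq (J.continuous_prod (hcont i) (hcont i)) (hcont i)
    · rw [Set.ofPred_forall]
      exact isClosed_iInter fun i =>
        isClosed_le continuous_const (continuous_const.mul (hcont i).norm)
    · simp only [Set.ofPred_forall]
      exact isClosed_iInter fun i => isClosed_iInter fun j => isClosed_iInter fun _ =>
        isClosed_eq (J.continuous_prod (hcont i) (hcont j)) continuous_const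
    · exact isClosed_eq (by fun_prop) continuous_const
  let Φ : (Fin N → ℝ) × (Fin N → E) → E := fun p => ∑ i, p.1 i • p.2 i
  have hΦ : Continuous Φ := by fun_prop
  have hmem : ∃ᶠ t in l, z t ∈ Φ '' K := by
    have hb : ∀ᶠ t in l, ‖z t‖ < ‖z₀‖ + 1 :=
      hz.norm.eventually_lt_const (lt_add_one _)
    refine (h.and_eventually hb).mono ?_
    rintro t ⟨⟨s, hs, hcard, σ, hσ⟩, ht⟩
    let eq := s.equivFinOfCardEq hcard
    have hid : ∀ i, J.IsIdempotent (eq.symm i : E) := fun i => hs.idem _ (eq.symm i).2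
    have h1 : ∀ i, 1 ≤ M * ‖(eq.symm i : E)‖ := fun i =>
      hM' _ (hid i) (hs.ne_zero _ (eq.symm i).2)
    refine ⟨(fun i => σ (eq.symm i), fun i => (eq.symm i : E)),
      ⟨⟨?_, ?_⟩, hid, h1, ?_, ?_⟩, ?_⟩
    · rw [mem_closedBall_zero_iff, pi_norm_le_iff_of_nonneg]
      · intro i
        have h2 := hs.inner_sum σ (eq.symm i).2
        rw [← hσ] at h2
        have h3 := abs_real_inner_le_norm (z t) (eq.symm i : E)
        rw [h2, abs_mul, abs_of_nonneg (sq_nonneg (‖(eq.symm i : E)‖))] at h3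
        have h4 : 0 < ‖(eq.symm i : E)‖ := norm_pos_iff.2 (hs.ne_zero _ (eq.symm i).2)
        have h5 : |σ (eq.symm i)| * ‖(eq.symm i : E)‖ ≤ ‖z t‖ := by
          refine le_of_mul_le_mul_right ?_ h4
          linarith
        rw [Real.norm_eq_abs]
        calc |σ (eq.symm i)| ≤ |σ (eq.symm i)| * (|M| * ‖(eq.symm i : E)‖) :=
              le_mul_of_one_le_right (abs_nonneg _) ((h1 i).trans
                (mul_le_mul_of_nonneg_right (le_abs_self M) h4.le))
          _ = (|σ (eq.symm i)| * ‖(eq.symm i : E)‖) * |M| := by ring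
          _ ≤ R := by
            refine mul_le_mul_of_nonneg_right ?_ (abs_nonneg _)
            linarith
      · positivity
    · rw [mem_closedBall_zero_iff, pi_norm_le_iff_of_nonneg (norm_nonneg _)]
      exact fun i => (hid i).norm_le
    · exact fun i j hij => hs.orth _ (eq.symm i).2 _ (eq.symm j).2 fun h' =>
        hij (eq.symm.injective (Subtype.ext h'))
    · rw [Equiv.sum_comp eq.symm (fun c : s => (c : E)), Finset.sum_coe_sort s (fun c => c),
        hs.sum_eq]
    · simp only [Φ]
      rw [Equiv.sum_comp eq.symm (fun c : s => σ c • (c : E)),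
        Finset.sum_coe_sort s (fun c => σ c • c), hσ]
  obtain ⟨⟨σ, c⟩, ⟨-, hid, hone, ho, hsum⟩, hz₀⟩ :=
    (hKc.image hΦ).isClosed.mem_of_frequently_of_tendsto hmem hz
  simp only [Φ] at hz₀ hid hone ho hsum
  have h0 : ∀ i, c i ≠ 0 := by
    intro i hi
    have := hone i
    rw [hi, norm_zero, mul_zero] at this
    linarith
  have hinj := injective_of_orthogonal hid h0 ho
  refine ⟨Finset.univ.image c, isSystem_image hid h0 ho hsum, ?_, fun x => ∑ i, if c i = x then σ i else 0, ?_⟩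
  · rw [Finset.card_image_of_injective _ hinj, Finset.card_univ, Fintype.card_fin]
  · rw [Finset.sum_image hinj.injOn, ← hz₀]
    refine Finset.sum_congr rfl fun i _ => ?_
    simp [hinj.eq_iff]

/-- If a system has the largest possible size, then every element is diagonalized by a system of
that size. -/
theorem IsSystem.exists_card_eq_isDiagonal [FiniteDimensional ℝ E] {s : Finset E}
    (hs : J.IsSystem s) (hmax : ∀ t, J.IsSystem t → t.card ≤ s.card) (z₀ : E) :
    ∃ t, J.IsSystem t ∧ t.card = s.card ∧ IsDiagonal t z₀ := by
  classical
  obtain ⟨σ, hσ⟩ := exists_injOn_real s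
  let z₁ := ∑ c ∈ s, σ c • c
  let ℓ : s → Polynomial ℝ := fun c => Lagrange.basis s σ c
  have hℓ : ∀ c : s, J.eval z₁ (ℓ c) = c := by
    intro c
    rw [hs.eval_sum, Finset.sum_eq_single (c : E)]
    · rw [Lagrange.eval_basis_self hσ c.2, one_smul]
    · intro d hd hdc
      rw [Lagrange.eval_basis_of_ne hdc.symm hd, zero_smul]
    · exact fun h => absurd c.2 h
  let z : ℝ → E := fun t => z₀ + t • (z₁ - z₀)
  have hzan : AnalyticOnNhd ℝ z Set.univ :=
    analyticOnNhd_const.add (analyticOnNhd_id.smul analyticOnNhd_const)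
  -- D t ≠ 0 says that the elements ℓ_c(z t) are independent. At t = 1 they are the members of s; D
  -- is analytic, so it has no zeros in a punctured neighbourhood of 0.
  let D : ℝ → ℝ := fun t => (Matrix.gram ℝ fun c => J.eval (z t) (ℓ c)).det
  have hD : AnalyticOnNhd ℝ D Set.univ := by
    simp only [D, Matrix.det_apply', Matrix.gram_apply]
    refine Finset.analyticOnNhd_fun_sum _ fun τ _ => AnalyticOnNhd.mul analyticOnNhd_const
      (Finset.analyticOnNhd_fun_prod _ fun i _ => ?_)
    intro t ht
    exact ((innerSL ℝ (E := E)).analyticAt_bilinear (_, _)).comp₂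
      (J.analyticOnNhd_eval hzan (ℓ (τ i)) t ht) (J.analyticOnNhd_eval hzan (ℓ i) t ht)
  have hD1 : D 1 ≠ 0 := by
    have h1 : z 1 = z₁ := by simp [z]
    simp only [D, h1, hℓ]
    exact Matrix.det_gram_ne_zero_iff_linearIndependent.2 hs.linearIndependent
  have hev : ∀ᶠ t in 𝓝[≠] (0 : ℝ), D t ≠ 0 := by
    by_contra hcon
    have hfr : ∃ᶠ t in 𝓝[≠] (0 : ℝ), D t = 0 :=
      (Filter.not_eventually.1 hcon).mono fun _ => not_not.1
    exact hD1 (hD.eqOn_zero_of_preconnected_of_frequently_eq_zero isPreconnected_univ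
      (Set.mem_univ 0) hfr (Set.mem_univ 1))
  have htend : Tendsto z (𝓝[≠] 0) (𝓝 z₀) := by
    have : Tendsto z (𝓝 0) (𝓝 (z 0)) := hzan.continuous.continuousAt
    simp only [z, zero_smul, add_zero] at this
    exact this.mono_left nhdsWithin_le_nhds
  refine isDiagonal_of_frequently htend (hev.mono fun t ht => ?_).frequently
  obtain ⟨u, hu, hd⟩ := J.exists_system_isDiagonal (z t)
  -- Polynomials in z t lie in the span of u, so `s.card` independent ones force u to be at least as
  -- large as s.
  refine ⟨u, hu, le_antisymm (hmax u hu) ?_, hd⟩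
  have hli := Matrix.det_gram_ne_zero_iff_linearIndependent.1 ht
  have hmem : ∀ c, J.eval (z t) (ℓ c) ∈ Submodule.span ℝ (u : Set E) := by
    intro c
    obtain ⟨τ, hτ⟩ := hd
    rw [hτ, hu.eval_sum]
    exact IsDiagonal.mem_span ⟨fun d => (ℓ c).eval (τ d), rfl⟩
  have hli' : LinearIndependent ℝ
      (fun c => (⟨_, hmem c⟩ : Submodule.span ℝ (u : Set E))) :=
    LinearIndependent.of_comp (Submodule.span ℝ (u : Set E)).subtype hli
  have := hli'.fintype_card_le_finrank
  rw [Fintype.card_coe] at this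
  exact this.trans (finrank_span_finset_le_card u)

/-- A combination of t with distinct coefficients is also diagonalized by some u with as many
members as s. Comparing polynomials in it, each d ∈ t is a sum of members of u; primitivity allows
only one summand, so u injects into t. -/
theorem IsSystem.card_le_of_isPrimitive [FiniteDimensional ℝ E] {s t : Finset E}
    (hs : J.IsSystem s) (hmax : ∀ t, J.IsSystem t → t.card ≤ s.card) (ht : J.IsSystem t)
    (hp : ∀ d ∈ t, J.IsPrimitive d) : s.card ≤ t.card := by
  classical
  obtain ⟨σ, hσ⟩ := exists_injOn_real t
  obtain ⟨u, hu, hcard, τ, hτ⟩ := hs.exists_card_eq_isDiagonal hmax (∑ d ∈ t, σ d • d)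
  rw [← hcard]
  have hev : ∀ p : Polynomial ℝ, ∑ d ∈ t, p.eval (σ d) • d = ∑ c ∈ u, p.eval (τ c) • c := by
    intro p
    rw [← ht.eval_sum, hτ, hu.eval_sum]
  have hex : ∀ c ∈ u, ∃ d ∈ t, σ d = τ c := by
    intro c hc
    -- This p annihilates the element when computed along t, hence also along u, so each τ c is a
    -- root.
    let p : Polynomial ℝ := ∏ d ∈ t, (Polynomial.X - Polynomial.C (σ d))
    have h0 : p.eval (τ c) = 0 := by
      refine hu.eq_zero_of_inner (σ := fun c => p.eval (τ c)) hc ?_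
      rw [← hev, Finset.sum_eq_zero, inner_zero_left]
      intro d hd
      rw [Polynomial.eval_prod, Finset.prod_eq_zero hd (by simp), zero_smul]
    rw [Polynomial.eval_prod, Finset.prod_eq_zero_iff] at h0
    obtain ⟨d, hd, h⟩ := h0
    refine ⟨d, hd, ?_⟩
    simp at h
    linarith
  choose! φ hφt hφ using hex
  refine Finset.card_le_card_of_injOn φ hφt fun c hc c' hc' hcc' => ?_
  by_contra hne
  have hc : c ∈ u := hc
  have hc' : c' ∈ u := hc'
  have hd := hφt c hc
  obtain ⟨d, hdc⟩ : ∃ d, φ c = d := ⟨_, rfl⟩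
  rw [hdc] at hd hcc'
  have h1 : d = ∑ x ∈ u, (if φ x = d then 1 else 0 : ℝ) • x := by
    have h2 := hev (Lagrange.basis t σ d)
    rw [Finset.sum_eq_single d, Lagrange.eval_basis_self hσ hd, one_smul] at h2
    · refine h2.trans (Finset.sum_congr rfl fun x hx => ?_)
      rw [← hφ x hx]
      split_ifs with h
      · rw [h, Lagrange.eval_basis_self hσ hd]
      · rw [Lagrange.eval_basis_of_ne (fun h' => h h'.symm) (hφt x hx)]
    · intro b hb hbd
      rw [Lagrange.eval_basis_of_ne (fun h' => hbd h'.symm) hb, zero_smul]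
    · exact fun h => absurd hd h
  -- Two members c, c' of the fibre of φ over d would split d into c and the rest of the fibre,
  -- which contains c'.
  let ρ : E → ℝ := fun x => if x ≠ c ∧ φ x = d then 1 else 0
  let δ : E → ℝ := fun x => if x = c then 1 else 0
  have hcδ : c = ∑ x ∈ u, δ x • x := by simp [δ, hc]
  refine (hp d hd).2.2 ⟨c, ∑ x ∈ u, ρ x • x, hu.idem c hc, ?_, hu.ne_zero c hc, ?_, ?_, ?_⟩
  · rw [IsIdempotent, hu.sum_prod_sum]
    refine Finset.sum_congr rfl fun x _ => ?_
    simp only [ρ]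
    split_ifs <;> simp
  · intro h0
    have : ρ c' = 0 := hu.eq_zero_of_inner hc' (by rw [h0, inner_zero_left])
    simp [ρ, hcc'.symm, Ne.symm hne] at this
  · nth_rw 1 [hcδ]
    rw [hu.sum_prod_sum]
    refine Finset.sum_eq_zero fun x _ => ?_
    simp only [ρ, δ]
    by_cases hx : x = c <;> simp [hx]
  · nth_rw 1 [hcδ]
    rw [← Finset.sum_add_distrib]
    refine h1.trans (Finset.sum_congr rfl fun x _ => ?_)
    rw [← add_smul]
    congr 1
    simp only [ρ, δ]
    by_cases hx : x = c <;> simp [hx, hdc]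

/-- All Jordan frames have the same number of elements. -/
theorem IsSystem.card_eq [FiniteDimensional ℝ E] {s t : Finset E}
    (hs : J.IsSystem s) (hps : ∀ d ∈ s, J.IsPrimitive d) (ht : J.IsSystem t)
    (hpt : ∀ d ∈ t, J.IsPrimitive d) : s.card = t.card := by
  classical
  let P : ℕ → Prop := fun k => ∃ u, J.IsSystem u ∧ u.card = k
  have hP : ∀ k, P k → k ≤ Module.finrank ℝ E := by
    rintro _ ⟨u, hu, rfl⟩
    exact hu.card_le
  obtain ⟨u, hu, hcard⟩ : P (Nat.findGreatest P (Module.finrank ℝ E)) :=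
    Nat.findGreatest_spec (hP _ ⟨s, hs, rfl⟩) ⟨s, hs, rfl⟩
  have hmax : ∀ v, J.IsSystem v → v.card ≤ u.card := fun v hv => by
    rw [hcard]
    exact Nat.le_findGreatest (hP _ ⟨v, hv, rfl⟩) ⟨v, hv, rfl⟩
  exact ((hmax s hs).antisymm (hu.card_le_of_isPrimitive hmax hs hps)).trans
    ((hmax t ht).antisymm (hu.card_le_of_isPrimitive hmax ht hpt)).symm

theorem algRank_eq_card [FiniteDimensional ℝ E] {s : Finset E}
    (hs : J.IsSystem s) (hp : ∀ c ∈ s, J.IsPrimitive c) : J.algRank = s.card := by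
  classical
  have hmem : s.card ∈ {r | ∃ c : Fin r → E, J.IsJordanFrame c} := ⟨_, hs.isJordanFrame hp⟩
  obtain ⟨c, hc⟩ := Nat.sInf_mem ⟨_, hmem⟩
  have h0 := fun i => (hc.1 i).2.1
  have hid := fun i => (hc.1 i).1
  have := hs.card_eq hp (isSystem_image hid h0 hc.2.1 hc.2.2) (by
    simp only [Finset.mem_image, Finset.mem_univ, true_and]
    rintro _ ⟨i, rfl⟩
    exact hc.1 i)
  rw [this, Finset.card_image_of_injective _ (injective_of_orthogonal hid h0 hc.2.1),
    Finset.card_univ, Fintype.card_fin]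
  rfl

/-! ### The cone of squares -/

theorem inner_nonneg_of_mem_cone {y c : E} (hy : y ∈ J.cone) (hc : J.IsIdempotent c) :
    0 ≤ inner ℝ y c := by
  obtain ⟨w, rfl⟩ := hy
  rw [J.inner_prod, J.prod_comm]
  exact hc.inner_prod_nonneg J w

theorem IsSystem.coeff_nonneg {s : Finset E} (hs : J.IsSystem s) {σ : E → ℝ}
    (h : ∀ c ∈ s, 0 ≤ inner ℝ (∑ c ∈ s, σ c • c) c) {c : E} (hc : c ∈ s) : 0 ≤ σ c := by
  have h1 := h c hc
  rw [hs.inner_sum σ hc] at h1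
  have : 0 < ‖c‖ := norm_pos_iff.2 (hs.ne_zero c hc)
  exact nonneg_of_mul_nonneg_left h1 (by positivity)

theorem IsSystem.sum_sqrt_prod_self {s : Finset E} (hs : J.IsSystem s) {σ : E → ℝ}
    (h : ∀ c ∈ s, 0 ≤ σ c) :
    J.prod (∑ c ∈ s, √(σ c) • c) (∑ c ∈ s, √(σ c) • c) = ∑ c ∈ s, σ c • c := by
  rw [hs.sum_prod_sum]
  exact Finset.sum_congr rfl fun c hc => by rw [Real.mul_self_sqrt (h c hc)]

theorem IsSystem.sum_mem_cone {s : Finset E} (hs : J.IsSystem s) {σ : E → ℝ}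
    (h : ∀ c ∈ s, 0 ≤ σ c) : ∑ c ∈ s, σ c • c ∈ J.cone :=
  ⟨_, hs.sum_sqrt_prod_self h⟩

theorem IsSystem.inner_eq_zero {s : Finset E} (hs : J.IsSystem s) {σ : E → ℝ}
    (hσ : ∑ c ∈ s, σ c • c ∈ J.cone) {z : E} (hz : z ∈ J.cone)
    (h : inner ℝ (∑ c ∈ s, σ c • c) z = 0) {c : E} (hc : c ∈ s) (hc0 : σ c ≠ 0) :
    inner ℝ c z = 0 := by
  rw [sum_inner, Finset.sum_eq_zero_iff_of_nonneg] at h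
  · have := h c hc
    rw [inner_smul_left] at this
    exact (mul_eq_zero.1 this).resolve_left hc0
  · intro d hd
    rw [inner_smul_left, real_inner_comm]
    exact mul_nonneg (hs.coeff_nonneg (fun c hc => inner_nonneg_of_mem_cone hσ (hs.idem c hc)) hd)
      (inner_nonneg_of_mem_cone hz (hs.idem d hd))

theorem IsIdempotent.mem_cone {c : E} (hc : J.IsIdempotent c) : c ∈ J.cone := ⟨c, hc⟩

/-- The inner product of the two sums is 0 and expands into nonnegative terms, so ⟨c, d⟩ = 0; for
idempotents this forces c∘d = 0. -/
theorem IsSystem.prod_eq_zero_of_complementary {s t : Finset E} (hs : J.IsSystem s)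
    (ht : J.IsSystem t) {σ τ : E → ℝ} (hσ : ∑ c ∈ s, σ c • c ∈ J.cone)
    (hτ : ∑ c ∈ t, τ c • c ∈ J.cone)
    (h : J.prod (∑ c ∈ t, τ c • c) (∑ c ∈ s, σ c • c) = 0) {c d : E} (hc : c ∈ s) (hc0 : σ c ≠ 0)
    (hd : d ∈ t) (hd0 : τ d ≠ 0) : J.prod c d = 0 := by
  have h1 := J.inner_eq_zero_of_prod_eq_zero h
  have h2 := ht.inner_eq_zero hτ hσ h1 hd hd0
  rw [real_inner_comm] at h2
  exact (hs.idem c hc).prod_eq_zero J (ht.idem d hd)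
    (hs.inner_eq_zero hσ (ht.idem d hd).mem_cone h2 hc hc0)

variable [FiniteDimensional ℝ E]

/-- The cone of squares is dual to the set of idempotents. -/
theorem mem_cone_iff {y : E} : y ∈ J.cone ↔ ∀ c, J.IsIdempotent c → 0 ≤ inner ℝ y c := by
  refine ⟨fun hy c hc => inner_nonneg_of_mem_cone hy hc, fun h => ?_⟩
  obtain ⟨s, hs, σ, rfl⟩ := J.exists_system_isDiagonal y
  exact hs.sum_mem_cone fun c => hs.coeff_nonneg fun c hc => h c (hs.idem c hc)

/-- The dual description makes the cone an intersection of closed half-spaces. -/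
theorem mem_cone_of_tendsto {X : Type*} {l : Filter X} [l.NeBot] {f : X → E} {y : E}
    (hf : Tendsto f l (𝓝 y)) (h : ∀ᶠ x in l, f x ∈ J.cone) : y ∈ J.cone :=
  mem_cone_iff.2 fun _ hc => ge_of_tendsto (hf.inner tendsto_const_nhds)
    (h.mono fun _ hx => inner_nonneg_of_mem_cone hx hc)

theorem exists_mem_cone_prod_self_eq {y : E} (hy : y ∈ J.cone) :
    ∃ w ∈ J.cone, J.prod w w = y := by
  obtain ⟨s, hs, σ, rfl⟩ := J.exists_system_isDiagonal y
  exact ⟨_, hs.sum_mem_cone fun c _ => Real.sqrt_nonneg _, hs.sum_sqrt_prod_self fun c =>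
    hs.coeff_nonneg fun c hc => inner_nonneg_of_mem_cone hy (hs.idem c hc)⟩

/-- Square roots in the cone are unique: both are the same polynomial in the square. -/
theorem eq_of_prod_self_eq {w w' : E} (hw : w ∈ J.cone) (hw' : w' ∈ J.cone)
    (h : J.prod w w = J.prod w' w') : w = w' := by
  classical
  obtain ⟨s, hs, σ, rfl⟩ := J.exists_system_isDiagonal w
  obtain ⟨t, ht, τ, rfl⟩ := J.exists_system_isDiagonal w'
  have h1 : ∀ c ∈ s, 0 ≤ σ c := fun c =>
    hs.coeff_nonneg fun c hc => inner_nonneg_of_mem_cone hw (hs.idem c hc)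
  have h2 : ∀ c ∈ t, 0 ≤ τ c := fun c =>
    ht.coeff_nonneg fun c hc => inner_nonneg_of_mem_cone hw' (ht.idem c hc)
  -- S holds the eigenvalues of both squares, so one polynomial interpolating √ on S recovers both w
  -- and w' from the common square.
  let S : Finset ℝ := s.image (fun c => σ c * σ c) ∪ t.image (fun c => τ c * τ c)
  let p := Lagrange.interpolate S id Real.sqrt
  have hp : ∀ x ∈ S, p.eval x = √x := fun x hx =>
    Lagrange.eval_interpolate_at_node (v := id) Real.sqrt (Set.injOn_id _) hx
  rw [hs.sum_prod_sum, ht.sum_prod_sum] at h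
  have h3 : J.eval _ p = J.eval _ p := congrArg (fun z => J.eval z p) h
  rw [hs.eval_sum, ht.eval_sum] at h3
  have e1 : ∑ c ∈ s, p.eval (σ c * σ c) • c = ∑ c ∈ s, σ c • c :=
    Finset.sum_congr rfl fun c hc => by
      rw [hp _ (Finset.mem_union_left _ (Finset.mem_image_of_mem _ hc)), Real.sqrt_mul_self (h1 c hc)]
  have e2 : ∑ c ∈ t, p.eval (τ c * τ c) • c = ∑ c ∈ t, τ c • c :=
    Finset.sum_congr rfl fun c hc => by
      rw [hp _ (Finset.mem_union_right _ (Finset.mem_image_of_mem _ hc)),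
        Real.sqrt_mul_self (h2 c hc)]
  rw [← e1, ← e2, h3]

variable (J) in
-- `sqrt` and `rank` unfold to the same chosen spectral decomposition, so a single system computes
-- both.
theorem exists_system_sqrt_rank (y : E) :
    ∃ (s : Finset E) (σ : E → ℝ), J.IsSystem s ∧ (∀ c ∈ s, J.IsPrimitive c) ∧
      y = ∑ c ∈ s, σ c • c ∧ J.sqrt y = ∑ c ∈ s, √(σ c) • c ∧
      J.rank y = (s.filter fun c => σ c ≠ 0).card := by
  classical
  have h := J.nonempty_spectralDecomposition y
  rw [rank, sqrt, dif_pos h, dif_pos h]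
  set D := Classical.choice h
  have hid := fun i => (D.isJordanFrame.1 i).1
  have h0 := fun i => (D.isJordanFrame.1 i).2.1
  have hinj := injective_of_orthogonal hid h0 D.isJordanFrame.2.1
  have hext : ∀ i, Function.extend D.frame D.eig 0 (D.frame i) = D.eig i :=
    fun i => hinj.extend_apply _ _ i
  refine ⟨Finset.univ.image D.frame, Function.extend D.frame D.eig 0,
    isSystem_image hid h0 D.isJordanFrame.2.1 D.isJordanFrame.2.2, ?_, ?_, ?_, ?_⟩
  · simp only [Finset.mem_image, Finset.mem_univ, true_and]
    rintro _ ⟨i, rfl⟩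
    exact D.isJordanFrame.1 i
  · simp only [Finset.sum_image hinj.injOn, hext]
    exact D.eq_sum
  · simp only [Finset.sum_image hinj.injOn, hext]
  · rw [Finset.filter_image, Finset.card_image_of_injective _ hinj]
    simp only [hext]

theorem sqrt_mem_cone (y : E) : J.sqrt y ∈ J.cone := by
  obtain ⟨s, σ, hs, -, -, h, -⟩ := J.exists_system_sqrt_rank y
  rw [h]
  exact hs.sum_mem_cone fun c _ => Real.sqrt_nonneg _

theorem sqrt_prod_sqrt {y : E} (hy : y ∈ J.cone) : J.prod (J.sqrt y) (J.sqrt y) = y := by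
  obtain ⟨s, σ, hs, -, h1, h2, -⟩ := J.exists_system_sqrt_rank y
  rw [h2]
  conv_rhs => rw [h1]
  rw [h1] at hy
  exact hs.sum_sqrt_prod_self fun c =>
    hs.coeff_nonneg fun c hc => inner_nonneg_of_mem_cone hy (hs.idem c hc)

/-! ### Complementarity -/

theorem prod_sqrt_eq_zero {y z : E} (hy : y ∈ J.cone) (hz : z ∈ J.cone) (h : J.prod z y = 0) :
    J.prod (J.sqrt y) z = 0 := by
  obtain ⟨s, σ, hs, -, h1, h2, -⟩ := J.exists_system_sqrt_rank y
  obtain ⟨t, ht, τ, rfl⟩ := J.exists_system_isDiagonal z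
  rw [h2]
  rw [h1] at hy h
  simp only [map_sum, LinearMap.sum_apply, map_smul, LinearMap.smul_apply]
  refine Finset.sum_eq_zero fun d hd => ?_
  by_cases hd0 : τ d = 0
  · rw [hd0, zero_smul]
  rw [Finset.sum_eq_zero, smul_zero]
  intro c hc
  by_cases hc0 : σ c = 0
  · simp [hc0]
  rw [hs.prod_eq_zero_of_complementary ht hy hz h hc hc0 hd hd0, smul_zero]

theorem rank_add_rank_eq_algRank {y z : E} (hy : y ∈ J.cone) (hz : z ∈ J.cone)
    (h : J.prod z y = 0)
    (hpos : ∀ w, w ≠ 0 → J.prod (J.sqrt y) w = 0 → 0 < inner ℝ (J.prod w w) z) :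
    J.rank y + J.rank z = J.algRank := by
  classical
  obtain ⟨s, σ, hs, hps, h1, h2, h3⟩ := J.exists_system_sqrt_rank y
  obtain ⟨t, τ, ht, hpt, h4, -, h5⟩ := J.exists_system_sqrt_rank z
  rw [h3, h5]
  set S := s.filter fun c => σ c ≠ 0 with hS
  set T := t.filter fun c => τ c ≠ 0 with hT
  have hort : ∀ c ∈ S, ∀ d ∈ T, J.prod c d = 0 := by
    intro c hc d hd
    rw [hS, Finset.mem_filter] at hc
    rw [hT, Finset.mem_filter] at hd
    exact hs.prod_eq_zero_of_complementary ht (h1 ▸ hy) (h4 ▸ hz) (h1 ▸ h4 ▸ h) hc.1 hc.2 hd.1 hd.2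
  have hself : ∀ {u U : Finset E}, J.IsSystem u → U ⊆ u → ∀ c ∈ U, J.prod c (∑ d ∈ U, d) = c := by
    intro u U hu hU c hc
    rw [map_sum, Finset.sum_eq_single_of_mem c hc, show J.prod c c = c from hu.idem c (hU hc)]
    exact fun d hd hdc => hu.orth c (hU hc) d (hU hd) hdc.symm
  have hSs : S ⊆ s := Finset.filter_subset _ _
  have hTt : T ⊆ t := Finset.filter_subset _ _
  -- The part of the unit outside both supports. It is annihilated by √y and by z, so `hpos` leaves
  -- only w = 0.
  set w := J.one - ∑ c ∈ S, c - ∑ d ∈ T, d with hw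
  have hwS : ∀ c ∈ S, J.prod c w = 0 := by
    intro c hc
    have : J.prod c (∑ d ∈ T, d) = 0 := by
      rw [map_sum]
      exact Finset.sum_eq_zero fun d hd => hort c hc d hd
    rw [hw, map_sub, map_sub, J.prod_one, hself hs hSs c hc, this, sub_self, sub_zero]
  have hwT : ∀ d ∈ T, J.prod d w = 0 := by
    intro d hd
    have : J.prod d (∑ c ∈ S, c) = 0 := by
      rw [map_sum]
      exact Finset.sum_eq_zero fun c hc => by rw [J.prod_comm, hort c hc d hd]
    rw [hw, map_sub, map_sub, J.prod_one, hself ht hTt d hd, this, sub_zero, sub_self]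
  have hw0 : w = 0 := by
    by_contra hne
    have hyw : J.prod (J.sqrt y) w = 0 := by
      rw [h2, map_sum, LinearMap.sum_apply]
      refine Finset.sum_eq_zero fun c hc => ?_
      rw [map_smul, LinearMap.smul_apply]
      by_cases hc0 : σ c = 0
      · rw [hc0, Real.sqrt_zero, zero_smul]
      · rw [hwS c (Finset.mem_filter.2 ⟨hc, hc0⟩), smul_zero]
    have hzw : J.prod w z = 0 := by
      rw [J.prod_comm, h4, map_sum, LinearMap.sum_apply]
      refine Finset.sum_eq_zero fun c hc => ?_
      rw [map_smul, LinearMap.smul_apply]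
      by_cases hc0 : τ c = 0
      · rw [hc0, zero_smul]
      · rw [hwT c (Finset.mem_filter.2 ⟨hc, hc0⟩), smul_zero]
    have := hpos w hne hyw
    rw [J.inner_prod, hzw, inner_zero_right] at this
    exact lt_irrefl _ this
  have hdisj : Disjoint S T := by
    rw [Finset.disjoint_left]
    intro c hc hc'
    have := hort c hc c hc'
    rw [show J.prod c c = c from hs.idem c (hSs hc)] at this
    exact hs.ne_zero c (hSs hc) this
  have hprim : ∀ c ∈ S ∪ T, J.IsPrimitive c := fun c hc =>
    (Finset.mem_union.1 hc).elim (fun h => hps c (hSs h)) (fun h => hpt c (hTt h))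
  have hsys : J.IsSystem (S ∪ T) := by
    refine ⟨fun c hc => (hprim c hc).1, fun c hc => (hprim c hc).2.1, ?_, ?_⟩
    · intro c hc d hd hcd
      rcases Finset.mem_union.1 hc with hc | hc <;> rcases Finset.mem_union.1 hd with hd | hd
      · exact hs.orth c (hSs hc) d (hSs hd) hcd
      · exact hort c hc d hd
      · rw [J.prod_comm]; exact hort d hd c hc
      · exact ht.orth c (hTt hc) d (hTt hd) hcd
    · rw [Finset.sum_union hdisj]
      rw [hw, sub_sub, sub_eq_zero] at hw0
      exact hw0.symm
  rw [algRank_eq_card hsys hprim, Finset.card_union_of_disjoint hdisj]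

end EuclideanJordanAlgebra

/-! ### Compactness along ultrafilters and Taylor expansion -/

section Analysis

theorem Ultrafilter.exists_tendsto_of_eventually_norm_le {X F : Type*} [NormedAddCommGroup F]
    [ProperSpace F] (U : Ultrafilter X) {a : X → F} {R : ℝ} (h : ∀ᶠ x in (U : Filter X), ‖a x‖ ≤ R) :
    ∃ b, Tendsto a U (𝓝 b) := by
  obtain ⟨b, -, hb⟩ := (isCompact_closedBall (0 : F) R).ultrafilter_le_nhds' (U.map a)
    (h.mono fun _ hx => mem_closedBall_zero_iff.2 hx)
  exact ⟨b, hb⟩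

/-- Second order Taylor expansion at a critical point. -/
theorem isLittleO_taylor_two_of_gradient_eq_zero {V : Type*} [NormedAddCommGroup V]
    [InnerProductSpace ℝ V] [CompleteSpace V] {F : V → ℝ} {x : V} {H : V →L[ℝ] V}
    (hF : Differentiable ℝ F) (h0 : gradient F x = 0) (hH : HasFDerivAt (gradient F) H x) :
    (fun z => F z - F x - (1 / 2) * inner ℝ (H (z - x)) (z - x)) =o[𝓝 x]
      fun z => ‖z - x‖ ^ 2 := by
  rw [Asymptotics.isLittleO_iff]
  intro ε hε
  have hlo := Asymptotics.isLittleO_iff.1 hH.isLittleO hε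
  obtain ⟨δ, hδ, hball⟩ := Metric.eventually_nhds_iff_ball.1 hlo
  refine Metric.eventually_nhds_iff_ball.2 ⟨δ, hδ, fun z hz => ?_⟩
  set u := z - x with hu
  -- F minus its quadratic model on the segment. Its derivative ⟨∇F(x + tu) − tHu, u⟩ is at most
  -- ε‖u‖² because ∇F(x) = 0, and the mean value inequality concludes.
  let ψ : ℝ → ℝ := fun t => F (x + t • u) - t ^ 2 * ((1 / 2) * inner ℝ (H u) u)
  have hψ : ∀ t, HasDerivAt ψ (inner ℝ (gradient F (x + t • u)) u - t * inner ℝ (H u) u) t := by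
    intro t
    have h1 : HasDerivAt (fun t : ℝ => x + t • u) u t := by
      simpa using ((hasDerivAt_id t).smul_const u).const_add x
    have h2 := (hF (x + t • u)).hasGradientAt.hasFDerivAt.comp_hasDerivAt t h1
    have h3 := ((hasDerivAt_pow 2 t).mul_const ((1 / 2) * inner ℝ (H u) u))
    refine (h2.sub h3).congr_deriv ?_
    rw [InnerProductSpace.toDual_apply_apply]
    push_cast
    ring
  have hbound : ∀ t ∈ Set.Ico (0 : ℝ) 1,
      ‖inner ℝ (gradient F (x + t • u)) u - t * inner ℝ (H u) u‖ ≤ ε * ‖u‖ ^ 2 := by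
    intro t ht
    have hmem : x + t • u ∈ Metric.ball x δ := by
      rw [mem_ball_iff_norm] at hz ⊢
      rw [add_sub_cancel_left, norm_smul, Real.norm_eq_abs, abs_of_nonneg ht.1]
      exact (mul_le_of_le_one_left (norm_nonneg _) ht.2.le).trans_lt hz
    have h1 := hball _ hmem
    rw [h0, sub_zero, add_sub_cancel_left, map_smul, norm_smul, Real.norm_eq_abs,
      abs_of_nonneg ht.1] at h1
    have h2 : inner ℝ (gradient F (x + t • u)) u - t * inner ℝ (H u) u
        = inner ℝ (gradient F (x + t • u) - t • H u) u := by
      rw [inner_sub_left, inner_smul_left]; rfl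
    rw [h2, Real.norm_eq_abs]
    refine (abs_real_inner_le_norm _ _).trans ?_
    calc _ ≤ (ε * (t * ‖u‖)) * ‖u‖ := by gcongr
      _ ≤ (ε * (1 * ‖u‖)) * ‖u‖ := by gcongr; exact ht.2.le
      _ = ε * ‖u‖ ^ 2 := by ring
  have := norm_image_sub_le_of_norm_deriv_le_segment_01'
    (fun t _ => (hψ t).hasDerivWithinAt) hbound
  have hz1 : x + u = z := by rw [hu]; abel
  simp only [ψ, one_smul, zero_smul, add_zero, hz1] at this
  rw [Real.norm_of_nonneg (sq_nonneg ‖u‖)]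
  refine (congrArg norm ?_).trans_le this
  ring

end Analysis

/-! ### Second order sufficiency through squared slack variables -/

namespace SymmetricConeProblem

variable {n m : ℕ} {E : Type*} [NormedAddCommGroup E] [InnerProductSpace ℝ E]
  {f : EuclideanSpace ℝ (Fin n) → ℝ} {h : EuclideanSpace ℝ (Fin n) → EuclideanSpace ℝ (Fin m)}
  {g : EuclideanSpace ℝ (Fin n) → E}

theorem contDiff_lagrangian (hf : ContDiff ℝ 2 f) (hh : ContDiff ℝ 2 h) (hg : ContDiff ℝ 2 g)
    (μ : EuclideanSpace ℝ (Fin m)) (lam : E) :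
    ContDiff ℝ 2 fun z => lagrangian f h g z μ lam :=
  (hf.sub (hh.inner ℝ contDiff_const)).sub (hg.inner ℝ contDiff_const)

theorem IsKKT.gradient_lagrangian [FiniteDimensional ℝ E] {J : EuclideanJordanAlgebra E}
    {x : EuclideanSpace ℝ (Fin n)} {μ : EuclideanSpace ℝ (Fin m)} {lam : E}
    (hk : IsKKT J f h g x μ lam) (hf : DifferentiableAt ℝ f x) (hh : DifferentiableAt ℝ h x)
    (hg : DifferentiableAt ℝ g x) : gradient (fun z => lagrangian f h g z μ lam) x = 0 := by
  have h1 := (hf.hasFDerivAt.sub (hh.hasFDerivAt.inner ℝ (hasFDerivAt_const μ x))).sub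
    (hg.hasFDerivAt.inner ℝ (hasFDerivAt_const lam x))
  have h2 : fderiv ℝ (fun z => lagrangian f h g z μ lam) x = 0 := by
    refine h1.fderiv.trans (ContinuousLinearMap.ext fun u => ?_)
    have h3 := congrArg (fun z => inner ℝ z u) hk.stationary
    simp only [inner_sub_left, LinearMap.adjoint_inner_left, inner_zero_left] at h3
    simp only [ContinuousLinearMap.coe_coe, inner_gradient_left] at h3
    simp [fderivInnerCLM_apply]
    rw [real_inner_comm μ, real_inner_comm lam]
    exact h3
  rw [gradient, h2, map_zero]

theorem IsKKT.isStrictLocalMinOn [FiniteDimensional ℝ E] {J : EuclideanJordanAlgebra E}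
    {x : EuclideanSpace ℝ (Fin n)} {μ : EuclideanSpace ℝ (Fin m)} {lam : E}
    (hk : IsKKT J f h g x μ lam)
    (hf : ContDiff ℝ 2 f) (hh : ContDiff ℝ 2 h) (hg : ContDiff ℝ 2 g)
    (hsosc : ∀ (v : EuclideanSpace ℝ (Fin n)) (w : E), (v, w) ≠ 0 →
      fderiv ℝ g x v - (2 : ℝ) • J.prod (J.sqrt (g x)) w = 0 → fderiv ℝ h x v = 0 →
      0 < inner ℝ (hessian (fun z => lagrangian f h g z μ lam) x v) v
          + 2 * inner ℝ (J.prod w w) lam) :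
    IsStrictLocalMinOn f (feasibleSet J h g) x := by
  refine ⟨⟨hk.eq_constraint, hk.constraint_mem⟩, ?_⟩
  by_contra hcon
  set y₀ := J.sqrt (g x) with hy₀
  set F := fun z => lagrangian f h g z μ lam with hF
  let B : Set (EuclideanSpace ℝ (Fin n)) := {z | z ∈ feasibleSet J h g ∧ z ≠ x ∧ f z ≤ f x}
  have hfreq : ∃ᶠ z in 𝓝 x, z ∈ B := by
    refine (Filter.not_eventually.1 hcon).mono fun z hz => ?_
    push Not at hz
    exact hz
  have hne : (𝓝 x ⊓ 𝓟 B).NeBot := Filter.frequently_mem_iff_neBot.1 hfreq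
  -- Along an ultrafilter every bounded function converges, which replaces passing to subsequences.
  let U := Ultrafilter.of (𝓝 x ⊓ 𝓟 B)
  have hU : (U : Filter (EuclideanSpace ℝ (Fin n))) ≤ 𝓝 x ⊓ 𝓟 B := Ultrafilter.of_le _
  have hUx : Tendsto (fun z => z) (U : Filter (EuclideanSpace ℝ (Fin n))) (𝓝 x) :=
    hU.trans inf_le_left
  have hUB : ∀ᶠ z in (U : Filter (EuclideanSpace ℝ (Fin n))), z ∈ B :=
    (hU.trans inf_le_right) (mem_principal_self B)
  have hgx : Tendsto g U (𝓝 (g x)) := hg.continuous.continuousAt.tendsto.comp hUx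
  have hroot : ∀ z, ∃ y, z ∈ B → y ∈ J.cone ∧ J.prod y y = g z := by
    intro z
    by_cases hz : z ∈ B
    · obtain ⟨y, hy⟩ := EuclideanJordanAlgebra.exists_mem_cone_prod_self_eq hz.1.2
      exact ⟨y, fun _ => hy⟩
    · exact ⟨0, fun h => absurd h hz⟩
  choose y hy using hroot
  have hprod : ∀ {a b : EuclideanSpace ℝ (Fin n) → E} {a' b' : E}, Tendsto a U (𝓝 a') →
      Tendsto b U (𝓝 b') → Tendsto (fun z => J.prod (a z) (b z)) U (𝓝 (J.prod a' b')) := by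
    intro a b a' b' ha hb
    exact ((J.continuous_prod continuous_fst continuous_snd).tendsto (a', b')).comp
      (ha.prodMk_nhds hb)
  -- The roots are bounded, as ‖y‖² = ⟨y∘y, e⟩; their limit lies in the cone and squares to g x, so
  -- it is y₀.
  have hylim : Tendsto y U (𝓝 y₀) := by
    obtain ⟨y', hy'⟩ : ∃ y', Tendsto y U (𝓝 y') := by
      refine U.exists_tendsto_of_eventually_norm_le (R := ‖g x‖ + 1 + ‖J.one‖) ?_
      filter_upwards [hUB, hgx.norm.eventually_lt_const (lt_add_one _)] with z hz hgz
      have h1 : ‖y z‖ ^ 2 = inner ℝ (g z) J.one := by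
        rw [← (hy z hz).2, J.inner_prod, J.prod_one, real_inner_self_eq_norm_sq]
      have h2 := real_inner_le_norm (g z) J.one
      by_contra! hlt
      nlinarith [norm_nonneg (g z), norm_nonneg J.one, norm_nonneg (y z), norm_nonneg (g x)]
    have hcone : y' ∈ J.cone :=
      EuclideanJordanAlgebra.mem_cone_of_tendsto hy' (hUB.mono fun z hz => (hy z hz).1)
    have hsq : J.prod y' y' = g x :=
      tendsto_nhds_unique ((hprod hy' hy').congr' (hUB.mono fun z hz => (hy z hz).2)) hgx
    rwa [EuclideanJordanAlgebra.eq_of_prod_self_eq hcone (EuclideanJordanAlgebra.sqrt_mem_cone _)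
      (hsq.trans (EuclideanJordanAlgebra.sqrt_prod_sqrt hk.constraint_mem).symm)] at hy'
  have hy₀sq : J.prod y₀ y₀ = g x := EuclideanJordanAlgebra.sqrt_prod_sqrt hk.constraint_mem
  have hy₀lam : J.prod y₀ lam = 0 :=
    EuclideanJordanAlgebra.prod_sqrt_eq_zero hk.constraint_mem hk.multiplier_mem hk.complementary
  let T : EuclideanSpace ℝ (Fin n) → ℝ := fun z => ‖(z - x, y z - y₀)‖
  have hTpos : ∀ z ∈ B, 0 < T z := fun z hz => norm_pos_iff.2 fun h0 =>
    hz.2.1 (sub_eq_zero.1 (congrArg Prod.fst h0))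
  have hd0 : Tendsto (fun z => z - x) (U : Filter (EuclideanSpace ℝ (Fin n))) (𝓝 0) :=
    sub_self x ▸ hUx.sub_const x
  obtain ⟨⟨v, w⟩, hvw⟩ :=
    U.exists_tendsto_of_eventually_norm_le (a := fun z => (T z)⁻¹ • (z - x, y z - y₀)) (R := 1)
      (hUB.mono fun z hz => by
        rw [norm_smul, norm_inv, Real.norm_of_nonneg (hTpos z hz).le]
        exact (inv_mul_cancel₀ (hTpos z hz).ne').le)
  have hvw0 : (v, w) ≠ 0 := by
    have h1 := hvw.norm
    have h2 : ‖(v, w)‖ = 1 := by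
      refine tendsto_nhds_unique h1 (tendsto_const_nhds.congr' (hUB.mono fun z hz => ?_))
      simp only
      rw [norm_smul, norm_inv, Real.norm_of_nonneg (hTpos z hz).le]
      exact (inv_mul_cancel₀ (hTpos z hz).ne').symm
    intro h0
    rw [h0, norm_zero] at h2
    exact zero_ne_one h2
  have hv : Tendsto (fun z => (T z)⁻¹ • (z - x)) U (𝓝 v) := (continuous_fst.tendsto _).comp hvw
  have hw : Tendsto (fun z => (T z)⁻¹ • (y z - y₀)) U (𝓝 w) := (continuous_snd.tendsto _).comp hvw
  have hhv : fderiv ℝ h x v = 0 := by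
    have h1 := (hh.differentiable (by norm_num) x).hasFDerivAt.hasFDerivWithinAt.lim hd0
      (.of_forall fun _ => Set.mem_univ _) hv
    refine tendsto_nhds_unique h1 (tendsto_const_nhds.congr' (hUB.mono fun z hz => ?_))
    simp only
    rw [add_sub_cancel, hk.eq_constraint, hz.1.1, sub_self, smul_zero]
  have hexp : ∀ z ∈ B, g z - g x = (2 : ℝ) • J.prod y₀ (y z - y₀) + J.prod (y z - y₀) (y z - y₀) := by
    intro z hz
    rw [← hy₀sq, ← (hy z hz).2]
    simp only [map_sub, LinearMap.sub_apply, J.prod_comm (y z) y₀]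
    module
  have hgv : fderiv ℝ g x v - (2 : ℝ) • J.prod y₀ w = 0 := by
    have h1 := (hg.differentiable (by norm_num) x).hasFDerivAt.hasFDerivWithinAt.lim hd0
      (.of_forall fun _ => Set.mem_univ _) hv
    -- In the quadratic remainder only one factor is divided by T; the other tends to 0.
    have h2 := ((hprod (tendsto_const_nhds (x := y₀)) hw).const_smul (2 : ℝ)).add
      (hprod (hylim.sub_const y₀) hw)
    rw [sub_self, map_zero, LinearMap.zero_apply, add_zero] at h2
    rw [sub_eq_zero]
    refine tendsto_nhds_unique h1 (h2.congr' (hUB.mono fun z hz => ?_))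
    simp only
    rw [add_sub_cancel, hexp z hz]
    simp only [map_smul, smul_add]
    module
  have hFC : ContDiff ℝ 2 F := contDiff_lagrangian hf hh hg μ lam
  have hF0 : gradient F x = 0 := hk.gradient_lagrangian (hf.differentiable (by norm_num) x)
    (hh.differentiable (by norm_num) x) (hg.differentiable (by norm_num) x)
  have hH : HasFDerivAt (gradient F) (hessian F x) x := by
    have h1 : Differentiable ℝ (fderiv ℝ F) :=
      (hFC.fderiv_right (m := 1) (by norm_num)).differentiable (by norm_num)
    exact ((InnerProductSpace.toDual ℝ (EuclideanSpace ℝ (Fin n))).symm.differentiable.comp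
      h1 x).hasFDerivAt
  have hlo := (isLittleO_taylor_two_of_gradient_eq_zero (hFC.differentiable (by norm_num)) hF0
    hH).mono (hU.trans inf_le_left)
  have hlo' : Tendsto (fun z => ((T z)⁻¹) ^ 2 *
      (F z - F x - (1 / 2) * inner ℝ (hessian F x (z - x)) (z - x))) U (𝓝 0) := by
    have h1 : (fun z => F z - F x - (1 / 2) * inner ℝ (hessian F x (z - x)) (z - x))
        =o[(U : Filter (EuclideanSpace ℝ (Fin n)))] fun z => T z ^ 2 := by
      refine hlo.trans_isBigO (Asymptotics.isBigO_of_le _ fun z => ?_)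
      rw [Real.norm_of_nonneg (by positivity), Real.norm_of_nonneg (by positivity)]
      gcongr
      exact norm_fst_le (z - x, y z - y₀)
    refine h1.tendsto_div_nhds_zero.congr fun z => ?_
    rw [div_eq_inv_mul, inv_pow]
  have hq : Tendsto (fun z => ((T z)⁻¹) ^ 2 * (F z - F x)) U
      (𝓝 ((1 / 2) * inner ℝ (hessian F x v) v)) := by
    have h1 := ((Tendsto.inner (𝕜 := ℝ) (((hessian F x).continuous.tendsto v).comp hv) hv).const_mul
      (1 / 2)).add hlo'
    rw [add_zero] at h1
    refine h1.congr fun z => ?_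
    simp only [Function.comp, map_smul, inner_smul_left, inner_smul_right, conj_trivial]
    ring
  have hr : Tendsto (fun z => -inner ℝ (J.prod ((T z)⁻¹ • (y z - y₀)) ((T z)⁻¹ • (y z - y₀))) lam) U
      (𝓝 (-inner ℝ (J.prod w w) lam)) :=
    ((hprod hw hw).inner tendsto_const_nhds).neg
  -- In the limit ½⟨∇²L v, v⟩ ≤ −⟨w∘w, λ⟩, against the hypothesis.
  have hle := le_of_tendsto_of_tendsto hq hr (hUB.mono fun z hz => ?_)
  · have := hsosc v w hvw0 hgv hhv
    linarith
  -- Uses f z ≤ f x and h z = h x = 0; the cross term 2⟨y₀∘(y z − y₀), λ⟩ vanishes since y₀∘λ = 0.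
  · have h1 : F z - F x ≤ -inner ℝ (J.prod (y z - y₀) (y z - y₀)) lam := by
      have h2 : F z - F x = f z - f x - inner ℝ (g z - g x) lam := by
        simp only [hF, lagrangian, hz.1.1, hk.eq_constraint, inner_sub_left]
        ring
      rw [h2, hexp z hz, inner_add_left, inner_smul_left, J.prod_comm y₀, J.inner_prod _ y₀, hy₀lam,
        inner_zero_right]
      linarith [hz.2.2]
    calc _ ≤ ((T z)⁻¹) ^ 2 * -inner ℝ (J.prod (y z - y₀) (y z - y₀)) lam :=
          mul_le_mul_of_nonneg_left h1 (sq_nonneg _)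
      _ = _ := by
        simp only [map_smul, LinearMap.smul_apply, inner_smul_left, conj_trivial]
        ring

end SymmetricConeProblem

theorem proposition6p1 {E : Type*} [NormedAddCommGroup E] [InnerProductSpace ℝ E]
    [FiniteDimensional ℝ E] (J : EuclideanJordanAlgebra E) {n m : ℕ}
    (f : EuclideanSpace ℝ (Fin n) → ℝ)
    (h : EuclideanSpace ℝ (Fin n) → EuclideanSpace ℝ (Fin m))
    (g : EuclideanSpace ℝ (Fin n) → E)
    (hf : ContDiff ℝ 2 f) (hh : ContDiff ℝ 2 h) (hg : ContDiff ℝ 2 g)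
    (x : EuclideanSpace ℝ (Fin n)) (μ : EuclideanSpace ℝ (Fin m)) (lam : E)
    (hkkt : SymmetricConeProblem.IsKKT J f h g x μ lam)
    (hsosc : ∀ (v : EuclideanSpace ℝ (Fin n)) (w : E), (v, w) ≠ 0 →
      fderiv ℝ g x v - (2 : ℝ) • J.prod (J.sqrt (g x)) w = 0 → fderiv ℝ h x v = 0 →
      0 < inner ℝ (SymmetricConeProblem.hessian
            (fun z => SymmetricConeProblem.lagrangian f h g z μ lam) x v) v
          + 2 * inner ℝ (J.prod w w) lam) :
    SymmetricConeProblem.IsStrictLocalMinOn f (SymmetricConeProblem.feasibleSet J h g) x ∧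
      lam ∈ J.cone ∧ SymmetricConeProblem.StrictComplementarity J g x lam := by
  refine ⟨hkkt.isStrictLocalMinOn hf hh hg hsosc, hkkt.multiplier_mem,
    EuclideanJordanAlgebra.rank_add_rank_eq_algRank hkkt.constraint_mem hkkt.multiplier_mem
      hkkt.complementary fun w hw hyw => ?_⟩
  -- With v = 0 the Hessian term disappears, leaving positivity of ⟨w∘w, λ⟩ on the kernel of
  -- L(√g(x)).
  have := hsosc 0 w (by simpa using hw) (by simp [hyw]) (map_zero _)
  rw [map_zero, inner_zero_left, zero_add] at this
  linarith
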